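/- Let $X$ be a real Banach space that is an $L^1$-predual space, i.e. its dual $X^*$ is linearly isometric to $L^1(\mu)$ for some positive measure $\mu$. Suppose that the norm of $X$ is strongly subdifferentiable: for every $x\in X$ with $\|x\|=1$, the limit $\lim_{t\to0^+}\frac{\|x+ty\|-\|x\|}{t}$ exists uniformly for $y$ in the closed unit ball of $X$. For $\|x\|=1$ put $S_x=\{x^*\in X^*:\|x^*\|=1,\ x^*(x)=1\}$. Then the norm of $X$ is quasi-polyhedral: for every $x\in X$ with $\|x\|=1$ there is $\delta>0$ such that $S_y\subseteq S_x$ for all $y\in X$ with $\|y\|=1$ and $\|y-x\|<\delta$. Moreover, $X^*$ is linearly isometric to $\ell^1(\Gamma)$ for some discrete set $\Gamma$; that is, $X$ is a quasi-polyhedral predual of $\ell^1(\Gamma)$. -/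

import Mathlib

open Set Filter Topology MeasureTheory
open scoped ENNReal

universe u v

/-- The norm of `X` is strongly subdifferentiable at `x`: the one-sided limit of
`(‖x + t y‖ - ‖x‖) / t` as `t → 0⁺` exists uniformly for `y` in the closed unit ball. -/
def StronglySubdifferentiableAt {X : Type u} [NormedAddCommGroup X] [NormedSpace ℝ X]
    (x : X) : Prop :=
  ∃ d : X → ℝ, TendstoUniformlyOn (fun (t : ℝ) (y : X) => (‖x + t • y‖ - ‖x‖) / t) d
    (𝓝[>] (0 : ℝ)) (Metric.closedBall (0 : X) 1)

/-- The norm of `X` is strongly subdifferentiable (SSD): it is so at every unit vector. -/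
def StronglySubdifferentiableNorm (X : Type u) [NormedAddCommGroup X] [NormedSpace ℝ X] : Prop :=
  ∀ x : X, ‖x‖ = 1 → StronglySubdifferentiableAt x

/-- The state space `S_x = {f ∈ X* : ‖f‖ = 1, f x = 1}`. -/
def stateSpace {X : Type u} [NormedAddCommGroup X] [NormedSpace ℝ X] (x : X) :
    Set (StrongDual ℝ X) :=
  {f | ‖f‖ = 1 ∧ f x = 1}

/-- The norm of `X` is quasi-polyhedral: every unit vector `x` has a `δ > 0` such that
`S_y ⊆ S_x` for all unit vectors `y` with `‖y - x‖ < δ`. -/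
def QuasiPolyhedralNorm (X : Type u) [NormedAddCommGroup X] [NormedSpace ℝ X] : Prop :=
  ∀ x : X, ‖x‖ = 1 → ∃ δ : ℝ, 0 < δ ∧ ∀ y : X, ‖y‖ = 1 → ‖y - x‖ < δ →
    stateSpace y ⊆ stateSpace x

/-- `X` is an `L¹`-predual space: its dual is linearly isometric to the real space `L¹(μ)` for
some (arbitrary positive) measure `μ`. -/
def IsL1Predual (X : Type u) [NormedAddCommGroup X] [NormedSpace ℝ X] : Prop :=
  ∃ (Ω : Type v) (_ : MeasurableSpace Ω) (μ : Measure Ω),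
    Nonempty (StrongDual ℝ X ≃ₗᵢ[ℝ] Lp ℝ 1 μ)

/-! The dual enters only through `L1Like`: two functionals have a common part (their median with
`0`) whose removal leaves remainders with additive norms, and disjointness is additive. Also, a part
of a functional attaining its norm at a point attains its own norm there.

Strong subdifferentiability puts every norm-one functional that almost attains its norm at `x`
within `1/2` of `S_x`. If `f ∈ S_y` with `y` near `x`, split off the median of `f` and a nearby
element of `S_x`: it attains its norm at `x`, while the remainder attains its norm at `y` and has at
most half the norm of `f`. Iterating gives `f x = 1`, so the norm is quasi-polyhedral.

By `QuasiPolyhedralNorm.wellFounded`, state spaces can be minimised. Among the points where some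
nonzero part of `f` attains its norm, take one with minimal state space; that part is an atom, since
a non-proportional subpart would yield, through Bishop–Phelps, a strictly smaller state space. So
every nonzero functional has an atomic part. Atoms on different lines are disjoint and span an
isometric `ℓ¹(Γ)`, and a functional outside it would have a best approximation with an atom-free
remainder. -/

/-! ### Medians and disjointness in `L¹` -/

theorem L1.norm_add_norm_eq_iff_ae {Ω : Type*} [MeasurableSpace Ω] {μ : Measure Ω}
    (f g : Lp ℝ 1 μ) :
    ‖f + g‖ = ‖f‖ + ‖g‖ ↔ ∀ᵐ ω ∂μ, |f ω + g ω| = |f ω| + |g ω| := by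
  have hf := L1.integrable_coeFn f
  have hg := L1.integrable_coeFn g
  have hsum : ‖f + g‖ = ∫ ω, |f ω + g ω| ∂μ := by
    rw [L1.norm_eq_integral_norm]
    refine integral_congr_ae ?_
    filter_upwards [Lp.coeFn_add f g] with ω hω
    rw [hω, Real.norm_eq_abs, Pi.add_apply]
  have hnn : ‖f‖ + ‖g‖ = ∫ ω, (|f ω| + |g ω|) ∂μ := by
    rw [L1.norm_eq_integral_norm, L1.norm_eq_integral_norm]
    exact (integral_add hf.norm hg.norm).symm
  have h := integral_eq_iff_of_ae_le (hf.add hg).abs (hf.abs.add hg.abs)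
    (Eventually.of_forall fun ω => abs_add_le (f ω) (g ω))
  rw [hsum, hnn]
  exact h

/-- The pointwise median of `0`, `f` and `g`. -/
theorem L1.exists_median {Ω : Type*} [MeasurableSpace Ω] {μ : Measure Ω} (f g : Lp ℝ 1 μ) :
    ∃ m : Lp ℝ 1 μ, ‖m‖ + ‖f - m‖ = ‖f‖ ∧ ‖m‖ + ‖g - m‖ = ‖g‖ ∧
      ‖f - m‖ + ‖g - m‖ = ‖f - g‖ := by
  -- At each point at most one summand is nonzero: the first where both values are positive, the
  -- second where both are negative.
  set m : Lp ℝ 1 μ := (f ⊓ g) ⊔ 0 + (f ⊔ g) ⊓ 0 with hm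
  have hmω : ∀ᵐ ω ∂μ, m ω = max (min (f ω) (g ω)) 0 + min (max (f ω) (g ω)) 0 := by
    filter_upwards [Lp.coeFn_add ((f ⊓ g) ⊔ 0) ((f ⊔ g) ⊓ 0), Lp.coeFn_sup (f ⊓ g) 0,
      Lp.coeFn_inf (f ⊔ g) 0, Lp.coeFn_sup f g, Lp.coeFn_inf f g, Lp.coeFn_zero ℝ 1 μ]
      with ω h1 h2 h3 h4 h5 h6
    rw [hm, h1, Pi.add_apply, h2, h3, Pi.sup_apply, Pi.inf_apply, h4, h5, h6]
    rfl
  have hfm := Lp.coeFn_sub f m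
  have hgm := Lp.coeFn_sub g m
  have hmg := Lp.coeFn_sub m g
  refine ⟨m, ?_, ?_, ?_⟩
  · rw [← (L1.norm_add_norm_eq_iff_ae m (f - m)).2, add_sub_cancel]
    filter_upwards [hmω, hfm] with ω h1 h2
    rw [h2, Pi.sub_apply, h1]
    grind
  · rw [← (L1.norm_add_norm_eq_iff_ae m (g - m)).2, add_sub_cancel]
    filter_upwards [hmω, hgm] with ω h1 h2
    rw [h2, Pi.sub_apply, h1]
    grind
  · rw [← norm_sub_rev m g, ← (L1.norm_add_norm_eq_iff_ae (f - m) (m - g)).2, sub_add_sub_cancel]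
    filter_upwards [hmω, hfm, hmg] with ω h1 h2 h3
    rw [h2, h3, Pi.sub_apply, Pi.sub_apply, h1]
    grind

/-- Two vectors span an `ℓ¹`-sum of lines up to signs; in `L¹` this is disjointness of supports. -/
def L1Disjoint {E : Type*} [NormedAddCommGroup E] (f g : E) : Prop :=
  ‖f + g‖ = ‖f‖ + ‖g‖ ∧ ‖f - g‖ = ‖f‖ + ‖g‖

theorem L1.disjoint_iff_ae {Ω : Type*} [MeasurableSpace Ω] {μ : Measure Ω} (f g : Lp ℝ 1 μ) :
    L1Disjoint f g ↔ ∀ᵐ ω ∂μ, f ω = 0 ∨ g ω = 0 := by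
  have hneg := Lp.coeFn_neg g
  have h2 := L1.norm_add_norm_eq_iff_ae f (-g)
  rw [norm_neg, ← sub_eq_add_neg] at h2
  rw [L1Disjoint, L1.norm_add_norm_eq_iff_ae, h2]
  constructor
  · rintro ⟨h3, h4⟩
    filter_upwards [h3, h4, hneg] with ω h3 h4 h5
    rw [h5, Pi.neg_apply] at h4
    grind
  · intro h
    constructor
    · filter_upwards [h] with ω h
      grind
    · filter_upwards [h, hneg] with ω h h5
      rw [h5, Pi.neg_apply]
      grind

theorem L1.disjoint_add {Ω : Type*} [MeasurableSpace Ω] {μ : Measure Ω} {f g h : Lp ℝ 1 μ}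
    (hf : L1Disjoint f h) (hg : L1Disjoint g h) : L1Disjoint (f + g) h := by
  rw [L1.disjoint_iff_ae] at *
  filter_upwards [hf, hg, Lp.coeFn_add f g] with ω h1 h2 h3
  rw [h3, Pi.add_apply]
  grind

/-- The features of the norm of an `L¹`-space that are used: medians, and additivity of
disjointness. -/
structure L1Like (E : Type*) [NormedAddCommGroup E] : Prop where
  exists_median : ∀ f g : E, ∃ m : E, ‖m‖ + ‖f - m‖ = ‖f‖ ∧ ‖m‖ + ‖g - m‖ = ‖g‖ ∧
    ‖f - m‖ + ‖g - m‖ = ‖f - g‖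
  disjoint_add : ∀ f g h : E, L1Disjoint f h → L1Disjoint g h → L1Disjoint (f + g) h

theorem L1Like.of_linearIsometryEquiv {E Ω : Type*} [NormedAddCommGroup E] [NormedSpace ℝ E]
    [MeasurableSpace Ω] {μ : Measure Ω} (T : E ≃ₗᵢ[ℝ] Lp ℝ 1 μ) : L1Like E where
  exists_median f g := by
    obtain ⟨m, h1, h2, h3⟩ := L1.exists_median (T f) (T g)
    refine ⟨T.symm m, ?_, ?_, ?_⟩
    all_goals simpa only [← T.norm_map, map_sub, T.apply_symm_apply]
  disjoint_add f g h hf hg := by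
    have key : ∀ a b : E, L1Disjoint (T a) (T b) ↔ L1Disjoint a b := fun a b => by
      simp only [L1Disjoint, ← map_add, ← map_sub, T.norm_map]
    rw [← key] at *
    rw [map_add]
    exact L1.disjoint_add hf hg

theorem IsL1Predual.l1Like_dual {X : Type u} [NormedAddCommGroup X] [NormedSpace ℝ X]
    (hX : IsL1Predual.{u, v} X) : L1Like (StrongDual ℝ X) := by
  obtain ⟨Ω, _, μ, ⟨T⟩⟩ := hX
  exact L1Like.of_linearIsometryEquiv T

/-! ### Strong subdifferentiability and almost norm-attaining functionals -/

section DirectionalDerivative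

variable {X : Type u} [NormedAddCommGroup X] [NormedSpace ℝ X]

/-- A linear functional dominated by a sum of two sublinear functionals is a sum of linear
functionals dominated by the respective summands. -/
theorem exists_linearMap_le_of_le_add {V : Type*} [AddCommGroup V] [Module ℝ V] (f : V →ₗ[ℝ] ℝ)
    (p q : V → ℝ) (hp : ∀ c : ℝ, 0 < c → ∀ x, p (c • x) = c * p x)
    (hp' : ∀ x y, p (x + y) ≤ p x + p y) (hq : ∀ c : ℝ, 0 < c → ∀ x, q (c • x) = c * q x)
    (hq' : ∀ x y, q (x + y) ≤ q x + q y) (hf : ∀ x, f x ≤ p x + q x) :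
    ∃ g : V →ₗ[ℝ] ℝ, (∀ x, g x ≤ p x) ∧ ∀ x, (f - g) x ≤ q x := by
  -- Hahn–Banach on `V × V`: extend `f` from the diagonal under `p z.1 + q z.2`, then restrict to
  -- the first factor.
  let D : Submodule ℝ (V × V) := LinearMap.range (LinearMap.id.prod LinearMap.id : V →ₗ[ℝ] V × V)
  let F : (V × V) →ₗ.[ℝ] ℝ := ⟨D, (f ∘ₗ LinearMap.fst ℝ V V) ∘ₗ D.subtype⟩
  have hp0 : p 0 = 0 := by
    have := hp 2 two_pos 0
    rw [smul_zero] at this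
    linarith
  have hq0 : q 0 = 0 := by
    have := hq 2 two_pos 0
    rw [smul_zero] at this
    linarith
  obtain ⟨G, hG, hGle⟩ := exists_extension_of_le_sublinear F (fun z => p z.1 + q z.2)
    (fun c hc z => by simp only [Prod.smul_fst, Prod.smul_snd, hp c hc, hq c hc]; ring)
    (fun y z => by
      have h1 := hp' y.1 z.1
      have h2 := hq' y.2 z.2
      simp only [Prod.fst_add, Prod.snd_add]
      linarith)
    (by rintro ⟨_, x, rfl⟩; exact hf x)
  refine ⟨G ∘ₗ LinearMap.inl ℝ V V, fun x => ?_, fun x => ?_⟩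
  · have := hGle (x, 0)
    simpa [hq0] using this
  · have h1 : G (x, x) = f x := hG ⟨(x, x), x, rfl⟩
    have h2 : G (x, x) = G (x, 0) + G (0, x) := by rw [← map_add]; simp
    have h3 := hGle (0, x)
    simp only [hp0, zero_add] at h3
    simp only [LinearMap.sub_apply, LinearMap.comp_apply, LinearMap.inl_apply]
    linarith

/-- The one-sided directional derivatives of a strongly subdifferentiable norm form a sublinear
functional. -/
theorem StronglySubdifferentiableAt.exists_sublinear {x : X}
    (h : StronglySubdifferentiableAt x) :
    ∃ D : X → ℝ, (∀ c : ℝ, 0 < c → ∀ y, D (c • y) = c * D y) ∧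
      (∀ y z, D (y + z) ≤ D y + D z) ∧
      (∀ y, Tendsto (fun t : ℝ => (‖x + t • y‖ - ‖x‖) / t) (𝓝[>] 0) (𝓝 (D y))) ∧
      TendstoUniformlyOn (fun (t : ℝ) (y : X) => (‖x + t • y‖ - ‖x‖) / t) D
        (𝓝[>] (0 : ℝ)) (Metric.closedBall (0 : X) 1) := by
  obtain ⟨d, hd⟩ := h
  have hmul : ∀ c : ℝ, 0 < c → Tendsto (fun t : ℝ => t * c) (𝓝[>] 0) (𝓝[>] 0) := by
    intro c hc
    refine tendsto_nhdsWithin_iff.2 ⟨?_, ?_⟩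
    · have : Tendsto (fun t : ℝ => t * c) (𝓝 0) (𝓝 (0 * c)) := (continuous_mul_const c).tendsto 0
      rw [zero_mul] at this
      exact this.mono_left nhdsWithin_le_nhds
    · filter_upwards [self_mem_nhdsWithin] with t ht
      exact mul_pos ht hc
  have hscale : ∀ (c : ℝ), 0 < c → ∀ (y : X) (l : ℝ),
      Tendsto (fun t : ℝ => (‖x + t • y‖ - ‖x‖) / t) (𝓝[>] 0) (𝓝 l) →
      Tendsto (fun t : ℝ => (‖x + t • (c • y)‖ - ‖x‖) / t) (𝓝[>] 0) (𝓝 (c * l)) := by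
    intro c hc y l hl
    refine ((hl.comp (hmul c hc)).const_mul c).congr' ?_
    filter_upwards [self_mem_nhdsWithin] with t ht
    have ht' : t ≠ 0 := ne_of_gt ht
    simp only [Function.comp_apply, smul_smul]
    field_simp
  have hlim : ∀ y : X, ∃ l, Tendsto (fun t : ℝ => (‖x + t • y‖ - ‖x‖) / t) (𝓝[>] 0) (𝓝 l) := by
    intro y
    have hc : 0 < ‖y‖ + 1 := by positivity
    have hmem : (‖y‖ + 1)⁻¹ • y ∈ Metric.closedBall (0 : X) 1 := by
      rw [mem_closedBall_zero_iff, norm_smul, norm_inv, Real.norm_of_nonneg hc.le,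
        inv_mul_le_iff₀ hc]
      linarith
    have := hscale _ hc _ _ (hd.tendsto_at hmem)
    rw [smul_inv_smul₀ hc.ne'] at this
    exact ⟨_, this⟩
  choose D hD using hlim
  have hDd : ∀ y ∈ Metric.closedBall (0 : X) 1, d y = D y := fun y hy =>
    tendsto_nhds_unique (hd.tendsto_at hy) (hD y)
  refine ⟨D, fun c hc y => tendsto_nhds_unique (hD _) (hscale c hc y _ (hD y)), fun y z => ?_, hD,
    hd.congr_right hDd⟩
  have h2 := hmul 2 two_pos
  refine le_of_tendsto_of_tendsto (hD (y + z)) (((hD y).comp h2).add ((hD z).comp h2)) ?_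
  filter_upwards [self_mem_nhdsWithin] with t ht
  have ht : 0 < t := ht
  have hsplit : (2 : ℝ) • (x + t • (y + z)) = (x + (t * 2) • y) + (x + (t * 2) • z) := by
    module
  have hnorm : 2 * ‖x + t • (y + z)‖ ≤ ‖x + (t * 2) • y‖ + ‖x + (t * 2) • z‖ := by
    rw [← Real.norm_of_nonneg (zero_le_two (α := ℝ)), ← norm_smul, Real.norm_of_nonneg zero_le_two,
      hsplit]
    exact norm_add_le _ _
  simp only [Function.comp_apply]
  rw [← add_div, div_le_div_iff₀ ht (by positivity)]
  nlinarith

/-- At a point of strong subdifferentiability, functionals of norm at most one which almost attain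
their norm are near to functionals which attain it. -/
theorem StronglySubdifferentiableAt.exists_stateSpace_near {x : X}
    (h : StronglySubdifferentiableAt x) (hx : ‖x‖ = 1) {ε : ℝ} (hε : 0 < ε) :
    ∃ δ : ℝ, 0 < δ ∧ ∀ f : StrongDual ℝ X, ‖f‖ ≤ 1 → 1 - δ ≤ f x →
      ∃ g ∈ stateSpace x, ‖f - g‖ ≤ ε := by
  obtain ⟨D, hDhom, hDadd, hDlim, hDunif⟩ := h.exists_sublinear
  have hev := Metric.tendstoUniformlyOn_iff.1 hDunif (ε / 2) (half_pos hε)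
  obtain ⟨t, hdist, ht⟩ := (hev.and self_mem_nhdsWithin).exists
  have ht : 0 < t := ht
  -- A single `t` serves the whole ball. After division by `t`, the defect `1 - f x` costs `ε / 2`,
  -- and so does the uniform error.
  refine ⟨ε / 2 * t, by positivity, fun f hf hfx => ?_⟩
  have hD0 : D 0 = 0 := by
    have := hDhom 2 two_pos 0
    rw [smul_zero] at this
    linarith
  have hball : ∀ y : X, ‖y‖ ≤ 1 → f y ≤ D y + ε := by
    intro y hy
    have h1 := hdist y (by simpa using hy)
    rw [Real.dist_eq] at h1
    have h2 := neg_lt_of_abs_lt h1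
    have h3 : f (x + t • y) ≤ ‖x + t • y‖ :=
      (le_abs_self _).trans ((f.le_opNorm _).trans (mul_le_of_le_one_left (norm_nonneg _) hf))
    rw [map_add, map_smul, smul_eq_mul] at h3
    have h4 : (‖x + t • y‖ - ‖x‖) / t ≤ D y + ε / 2 := by linarith
    rw [div_le_iff₀ ht, hx] at h4
    have : t * f y ≤ t * (D y + ε) := by nlinarith
    exact le_of_mul_le_mul_left this ht
  have hle : ∀ y : X, f y ≤ D y + ε * ‖y‖ := by
    intro y
    rcases eq_or_ne y 0 with rfl | hy
    · simp [hD0]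
    · have hy' : 0 < ‖y‖ := norm_pos_iff.2 hy
      have h1 := hball (‖y‖⁻¹ • y) (by rw [norm_smul, norm_inv, norm_norm, inv_mul_cancel₀ hy'.ne'])
      rw [hDhom _ (inv_pos.2 hy'), map_smul, smul_eq_mul] at h1
      have h2 := mul_le_mul_of_nonneg_left h1 hy'.le
      rw [mul_inv_cancel_left₀ hy'.ne', mul_add, mul_inv_cancel_left₀ hy'.ne'] at h2
      linarith
  -- Domination by `D` puts `g` in the state space, because `D y ≤ ‖y‖` and `D (-x) ≤ -1`; the other
  -- summand bounds `f - g`.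
  obtain ⟨g, hgD, hfg⟩ := exists_linearMap_le_of_le_add f.toLinearMap D (fun y => ε * ‖y‖) hDhom hDadd
    (fun c hc y => by rw [norm_smul, Real.norm_of_nonneg hc.le]; ring)
    (fun y z => by rw [← mul_add]; exact mul_le_mul_of_nonneg_left (norm_add_le y z) hε.le) hle
  have hDnorm : ∀ y, D y ≤ ‖y‖ := by
    intro y
    refine le_of_tendsto (hDlim y) ?_
    filter_upwards [self_mem_nhdsWithin] with s hs
    have hs : 0 < s := hs
    rw [div_le_iff₀ hs, sub_le_iff_le_add']
    refine (norm_add_le _ _).trans ?_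
    rw [norm_smul, Real.norm_of_nonneg hs.le, mul_comm]
  have hDx : D (-x) ≤ -1 := by
    refine le_of_tendsto (hDlim (-x)) ?_
    filter_upwards [self_mem_nhdsWithin, mem_nhdsWithin_of_mem_nhds (Iio_mem_nhds one_pos)]
      with s hs hs1
    have hs : 0 < s := hs
    have hs1 : s < 1 := hs1
    have : x + s • -x = (1 - s) • x := by module
    rw [this, norm_smul, hx, Real.norm_of_nonneg (by linarith), div_le_iff₀ hs]
    linarith
  have habs : ∀ y, |g y| ≤ 1 * ‖y‖ := by
    intro y
    have h1 := (hgD y).trans (hDnorm y)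
    have h2 := (hgD (-y)).trans (hDnorm (-y))
    rw [map_neg, norm_neg] at h2
    rw [one_mul, abs_le]
    exact ⟨by linarith, h1⟩
  let g' : StrongDual ℝ X := g.mkContinuous 1 habs
  have hg'1 : ‖g'‖ ≤ 1 := g.mkContinuous_norm_le zero_le_one habs
  have hgx : 1 ≤ g' x := by
    have := (hgD (-x)).trans hDx
    rw [map_neg] at this
    change 1 ≤ g x
    linarith
  have hgx' : g' x ≤ ‖g'‖ := by
    have := (le_abs_self _).trans (g'.le_opNorm x)
    rwa [hx, mul_one] at this
  refine ⟨g', ⟨by linarith, by linarith⟩, ContinuousLinearMap.opNorm_le_bound _ hε.le fun y => ?_⟩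
  have h1 := hfg y
  have h2 := hfg (-y)
  rw [map_neg, norm_neg] at h2
  rw [Real.norm_eq_abs]
  refine abs_le.2 ⟨?_, h1⟩
  change -(ε * ‖y‖) ≤ (f.toLinearMap - g) y
  linarith

end DirectionalDerivative

/-! ### Parts of a vector and quasi-polyhedrality -/

/-- `h` is a part of `f`: the norm is additive on the decomposition `f = h + (f - h)`. -/
def IsPart {E : Type*} [NormedAddCommGroup E] (h f : E) : Prop :=
  ‖h‖ + ‖f - h‖ = ‖f‖

namespace IsPart

variable {E : Type*} [NormedAddCommGroup E] {f g h : E}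

theorem of_le (hh : ‖h‖ + ‖f - h‖ ≤ ‖f‖) : IsPart h f :=
  le_antisymm hh (by simpa using norm_add_le h (f - h))

theorem sub_left (hh : IsPart h f) : IsPart (f - h) f := by
  rw [IsPart, sub_sub_cancel, add_comm]
  exact hh

theorem trans (h1 : IsPart f g) (h2 : IsPart g h) : IsPart f h := by
  refine of_le ?_
  rw [IsPart] at h1 h2
  have := norm_add_le (h - g) (g - f)
  rw [sub_add_sub_cancel] at this
  linarith

theorem smul [NormedSpace ℝ E] (hh : IsPart h f) (c : ℝ) : IsPart (c • h) (c • f) := by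
  rw [IsPart] at *
  rw [← smul_sub, norm_smul, norm_smul, norm_smul, ← mul_add, hh]

end IsPart

section Dual

variable {X : Type u} [NormedAddCommGroup X] [NormedSpace ℝ X]

theorem StrongDual.apply_le_norm (f : StrongDual ℝ X) {x : X} (hx : ‖x‖ ≤ 1) : f x ≤ ‖f‖ :=
  (le_abs_self _).trans (f.unit_le_opNorm x hx)

/-- The values of `h` and `f - h` at `x` are bounded by norms that add up to `f x`, so both bounds
are equalities. -/
theorem IsPart.apply_eq_norm {f h : StrongDual ℝ X} (hh : IsPart h f) {x : X} (hx : ‖x‖ ≤ 1)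
    (hf : f x = ‖f‖) : h x = ‖h‖ := by
  rw [IsPart] at hh
  have h1 := h.apply_le_norm hx
  have h2 := (f - h).apply_le_norm hx
  rw [sub_apply] at h2
  linarith

theorem inv_norm_smul_mem_stateSpace {f : StrongDual ℝ X} (hf0 : f ≠ 0) {x : X}
    (hf : f x = ‖f‖) : ‖f‖⁻¹ • f ∈ stateSpace x := by
  have h : ‖f‖ ≠ 0 := norm_ne_zero_iff.2 hf0
  refine ⟨by rw [norm_smul, norm_inv, norm_norm, inv_mul_cancel₀ h], ?_⟩
  rw [smul_apply, hf, smul_eq_mul, inv_mul_cancel₀ h]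

theorem stateSpace_nonempty {x : X} (hx : ‖x‖ = 1) : (stateSpace x).Nonempty := by
  obtain ⟨g, hg, hgx⟩ := exists_dual_vector ℝ x (by rw [hx]; exact one_ne_zero)
  exact ⟨g, hg, by rw [hgx, hx]; rfl⟩

theorem L1Like.quasiPolyhedralNorm (hE : L1Like (StrongDual ℝ X))
    (hssd : StronglySubdifferentiableNorm X) : QuasiPolyhedralNorm X := by
  intro x hx
  obtain ⟨δ, hδ, hnear⟩ := (hssd x hx).exists_stateSpace_near hx one_half_pos
  refine ⟨δ, hδ, fun y hy hyx f hf => ⟨hf.1, ?_⟩⟩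
  -- Stated for every functional attaining its norm at `y`, because the induction passes to the
  -- remainder `F - m`. Removing `m` leaves the defect at `x` unchanged and halves the bound.
  have key : ∀ n : ℕ, ∀ f : StrongDual ℝ X, f y = ‖f‖ → ‖f‖ - f x ≤ 2 * ‖f‖ * (1 / 2) ^ n := by
    intro n
    induction n with
    | zero =>
      intro f _
      have := (neg_le_abs _).trans (f.unit_le_opNorm x hx.le)
      linarith
    | succ n ih =>
      intro f hf
      rcases eq_or_ne f 0 with rfl | hf0
      · simp
      have hnf : 0 < ‖f‖ := norm_pos_iff.2 hf0
      obtain ⟨hF, hFy⟩ := inv_norm_smul_mem_stateSpace hf0 hf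
      set F := ‖f‖⁻¹ • f with hFdef
      have hfF : f = ‖f‖ • F := by rw [hFdef, smul_inv_smul₀ hnf.ne']
      have hFx : 1 - δ ≤ F x := by
        have h1 := F.le_opNorm (y - x)
        rw [hF, one_mul, map_sub, hFy] at h1
        have h2 := (le_abs_self _).trans h1
        linarith
      obtain ⟨g, ⟨hg, hgx⟩, hFg⟩ := hnear F hF.le hFx
      obtain ⟨m, hm1, hm2, hm3⟩ := hE.exists_median F g
      have hmx : m x = ‖m‖ := IsPart.apply_eq_norm hm2 hx.le (by rw [hgx, hg])
      have hmF : IsPart (F - m) F := IsPart.sub_left hm1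
      have h1 := ih (F - m) (hmF.apply_eq_norm hy.le (by rw [hFy, hF]))
      rw [sub_apply, hmx] at h1
      have h2 : ‖F - m‖ ≤ 1 / 2 := by linarith [norm_nonneg (g - m)]
      have h3 : ‖F‖ - F x ≤ 2 * (1 / 2) ^ (n + 1) := by
        have : 2 * ‖F - m‖ * (1 / 2) ^ n ≤ 2 * (1 / 2) * (1 / 2) ^ n := by gcongr
        rw [pow_succ]
        linarith
      have h4 : f x = ‖f‖ * F x := by
        conv_lhs => rw [hfF]
        rfl
      rw [hF] at h3
      rw [h4]
      nlinarith
  have hlim : Tendsto (fun n : ℕ => 2 * ‖f‖ * (1 / 2 : ℝ) ^ n) atTop (𝓝 (2 * ‖f‖ * 0)) :=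
    (tendsto_pow_atTop_nhds_zero_of_lt_one one_half_pos.le one_half_lt_one).const_mul _
  have h0 := ge_of_tendsto' hlim fun n => key n f (by rw [hf.1, hf.2])
  have h1 := f.apply_le_norm hx.le
  rw [hf.1] at h0 h1
  linarith

/-- A quasi-polyhedral norm satisfies the descending chain condition for state spaces. -/
theorem QuasiPolyhedralNorm.wellFounded [CompleteSpace X] (hX : QuasiPolyhedralNorm X) :
    WellFounded fun x y : {x : X // ‖x‖ = 1} => stateSpace x.1 ⊂ stateSpace y.1 := by
  rw [wellFounded_iff_isEmpty_descending_chain]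
  refine ⟨fun ⟨s, hs⟩ => ?_⟩
  have hanti : Antitone fun n => stateSpace (s n).1 := antitone_nat_of_succ_le fun n => (hs n).1
  -- Average the chain with weights of total `1`. The normalised partial sums carry `S_{s N}` in
  -- their state spaces and tend to `x`, so `S_{s N} ⊆ S_x` for some `N`.
  have hwsum : HasSum (fun n : ℕ => (1 / 2 : ℝ) / 2 ^ n) 1 := hasSum_geometric_two' 1
  have hnorm : ∀ n, ‖((1 / 2 : ℝ) / 2 ^ n) • (s n).1‖ = (1 / 2 : ℝ) / 2 ^ n := fun n => by
    rw [norm_smul, (s n).2, mul_one, Real.norm_of_nonneg (by positivity)]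
  have hsum : Summable fun n => ((1 / 2 : ℝ) / 2 ^ n) • (s n).1 :=
    Summable.of_norm (hwsum.summable.congr fun n => (hnorm n).symm)
  obtain ⟨x, hxs⟩ := hsum
  let y : ℕ → X := fun N => ∑ n ∈ Finset.range N, ((1 / 2 : ℝ) / 2 ^ n) • (s n).1
  let w : ℕ → ℝ := fun N => ∑ n ∈ Finset.range N, (1 / 2 : ℝ) / 2 ^ n
  have hy : Tendsto y atTop (𝓝 x) := hxs.tendsto_sum_nat
  have hwlim : Tendsto w atTop (𝓝 1) := hwsum.tendsto_sum_nat
  have hfy : ∀ N, ∀ f ∈ stateSpace (s N).1, f (y (N + 1)) = w (N + 1) := by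
    intro N f hf
    simp only [y, w, map_sum, map_smul]
    refine Finset.sum_congr rfl fun n hn => ?_
    rw [(hanti (Nat.lt_succ_iff.1 (Finset.mem_range.1 hn)) hf).2, smul_eq_mul, mul_one]
  have hwpos : ∀ N, 0 < w (N + 1) := fun N => Finset.sum_pos (fun n _ => by positivity) (by simp)
  have hny : ∀ N, ‖y (N + 1)‖ = w (N + 1) := by
    intro N
    refine le_antisymm ((norm_sum_le _ _).trans_eq (Finset.sum_congr rfl fun n _ => hnorm n)) ?_
    obtain ⟨f, hf⟩ := stateSpace_nonempty (s N).2
    rw [← hfy N f hf]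
    have := (le_abs_self _).trans (f.le_opNorm (y (N + 1)))
    rwa [hf.1, one_mul] at this
  have hy1 : Tendsto (fun N => y (N + 1)) atTop (𝓝 x) := hy.comp (tendsto_add_atTop_nat 1)
  have hw1 : Tendsto (fun N => w (N + 1)) atTop (𝓝 1) := hwlim.comp (tendsto_add_atTop_nat 1)
  have hx : ‖x‖ = 1 := tendsto_nhds_unique hy1.norm (hw1.congr fun N => (hny N).symm)
  obtain ⟨δ, hδ, hsub⟩ := hX x hx
  have hlim : Tendsto (fun N => (w (N + 1))⁻¹ • y (N + 1)) atTop (𝓝 x) := by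
    have := (hw1.inv₀ one_ne_zero).smul hy1
    rwa [inv_one, one_smul] at this
  obtain ⟨N, hN⟩ := (Metric.tendsto_nhds.1 hlim δ hδ).exists
  rw [dist_eq_norm] at hN
  refine (hs N).2 fun f hf => ?_
  have hfx : f ∈ stateSpace x := by
    refine hsub _ ?_ hN ⟨hf.1, ?_⟩
    · rw [norm_smul, hny, norm_inv, Real.norm_of_nonneg (hwpos N).le, inv_mul_cancel₀ (hwpos N).ne']
    · rw [map_smul, hfy N f hf, smul_eq_mul, inv_mul_cancel₀ (hwpos N).ne']
  refine ⟨hf.1, ?_⟩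
  have hle : ∀ n, f (s n).1 ≤ 1 := fun n =>
    (f.apply_le_norm (s n).2.le).trans_eq hf.1
  -- As `f x = 1` averages numbers at most `1`, all of them equal `1`. The one at `N + 1`
  -- contradicts strictness of the chain.
  have hgap : HasSum (fun n : ℕ => (1 / 2 : ℝ) / 2 ^ n * (1 - f (s n).1)) 0 := by
    have h1 := hwsum.sub (hxs.mapL f)
    rw [hfx.2, sub_self] at h1
    refine h1.congr_fun ?_
    intro n
    rw [map_smul, smul_eq_mul]
    ring
  have hz := (hasSum_zero_iff_of_nonneg fun n =>
    mul_nonneg (by positivity) (sub_nonneg.2 (hle n))).1 hgap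
  have := congrFun hz (N + 1)
  rcases mul_eq_zero.1 this with h | h
  · exact absurd h (by positivity)
  · linarith

end Dual

/-! ### Ekeland's principle and the Bishop–Phelps theorem -/

/-- A form of Ekeland's variational principle. -/
theorem exists_maximal_of_continuous_bddAbove {α : Type*} [MetricSpace α] [CompleteSpace α]
    {φ : α → ℝ} (hφ : Continuous φ) (hb : BddAbove (range φ)) (a : α) :
    ∃ b, dist a b ≤ φ b - φ a ∧ ∀ c, dist b c ≤ φ c - φ b → c = b := by
  let S : α → Set α := fun b => {c | dist b c ≤ φ c - φ b}
  have hself : ∀ b, b ∈ S b := fun b => by simp [S]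
  have htrans : ∀ {b c d}, c ∈ S b → d ∈ S c → d ∈ S b := by
    intro b c d h1 h2
    simp only [S, mem_ofPred_eq] at *
    linarith [dist_triangle b c d]
  have hbdd : ∀ b, BddAbove (φ '' S b) := fun b => hb.mono (image_subset_range _ _)
  -- An almost maximal choice leaves little room for `φ` to grow, so the next set `S c` has small
  -- radius about `c`.
  have hnext : ∀ (n : ℕ) (b : α), ∃ c ∈ S b, sSup (φ '' S b) - 1 / ((n : ℝ) + 1) < φ c := by
    intro n b
    obtain ⟨_, ⟨c, hc, rfl⟩, h⟩ := exists_lt_of_lt_csSup ⟨_, mem_image_of_mem φ (hself b)⟩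
      (sub_lt_self (sSup (φ '' S b)) (Nat.one_div_pos_of_nat (n := n)))
    exact ⟨c, hc, h⟩
  choose next hnextS hnextφ using hnext
  let x : ℕ → α := fun n => Nat.rec a next n
  have hx : ∀ n m, n ≤ m → x m ∈ S (x n) := by
    intro n m h
    induction m, h using Nat.le_induction with
    | base => exact hself _
    | succ m _ ih => exact htrans ih (hnextS m (x m))
  have hclose : ∀ (n : ℕ) (c : α), c ∈ S (x (n + 1)) →
      dist (x (n + 1)) c ≤ 1 / ((n : ℝ) + 1) := by
    intro n c hc
    have h1 := le_csSup (hbdd (x n)) (mem_image_of_mem φ (htrans (hnextS n (x n)) hc))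
    have h2 := hnextφ n (x n)
    have h3 : dist (x (n + 1)) c ≤ φ c - φ (x (n + 1)) := hc
    have h4 : φ (x (n + 1)) = φ (next n (x n)) := rfl
    linarith
  have hlim0 : Tendsto (fun n : ℕ => 1 / ((n : ℝ) + 1)) atTop (𝓝 0) :=
    tendsto_one_div_add_atTop_nhds_zero_nat
  have hcau : CauchySeq fun n => x (n + 1) := by
    refine cauchySeq_of_le_tendsto_0' (fun n : ℕ => 1 / ((n : ℝ) + 1)) (fun n m h => ?_) hlim0
    exact hclose n _ (hx _ _ (Nat.succ_le_succ h))
  obtain ⟨b, hxb⟩ := cauchySeq_tendsto_of_complete hcau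
  have hbS : ∀ n, b ∈ S (x n) := by
    intro n
    have hcl : IsClosed (S (x n)) :=
      isClosed_le (continuous_const.dist continuous_id) (hφ.sub continuous_const)
    refine hcl.mem_of_tendsto hxb ?_
    filter_upwards [eventually_ge_atTop n] with m hm
    exact hx n (m + 1) (by omega)
  refine ⟨b, hbS 0, fun c hc => ?_⟩
  refine tendsto_nhds_unique (tendsto_iff_dist_tendsto_zero.2 ?_) hxb
  exact squeeze_zero (fun _ => dist_nonneg) (fun n => hclose n c (htrans (hbS (n + 1)) hc)) hlim0

theorem StrongDual.exists_lt_apply {X : Type u} [NormedAddCommGroup X] [NormedSpace ℝ X]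
    (f : StrongDual ℝ X) {r : ℝ} (hr : r < ‖f‖) : ∃ x : X, ‖x‖ ≤ 1 ∧ r < f x := by
  obtain ⟨x, hx1, hx⟩ := f.exists_lt_apply_of_lt_opNorm hr
  rcases le_total 0 (f x) with h | h
  · exact ⟨x, hx1.le, by rwa [Real.norm_of_nonneg h] at hx⟩
  · exact ⟨-x, by rw [norm_neg]; exact hx1.le, by rwa [map_neg, ← Real.norm_of_nonpos h]⟩

section BishopPhelps

variable {X : Type u} [NormedAddCommGroup X] [NormedSpace ℝ X]

/-- If a nonzero functional `g` is nonnegative where `f` exceeds half the norm, then `f` is within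
`1/2` of a positive multiple of `g`. -/
theorem exists_pos_smul_norm_sub_le {f g : StrongDual ℝ X} (hf : ‖f‖ = 1) (hg : g ≠ 0)
    (hfg : ∀ x, 1 / 2 * ‖x‖ < f x → 0 ≤ g x) : ∃ c : ℝ, 0 < c ∧ ‖f - c • g‖ ≤ 1 / 2 := by
  have hpos : ∀ x, 1 / 2 * ‖x‖ < f x → 0 < g x := by
    intro x hx
    refine (hfg x hx).lt_of_ne fun h0 => hg ?_
    have hopen : {y : X | 1 / 2 * ‖y‖ < f y} ∈ 𝓝 x :=
      (isOpen_lt (continuous_const.mul continuous_norm) f.continuous).mem_nhds hx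
    ext v
    have hcont : Tendsto (fun t : ℝ => x + t • v) (𝓝 0) (𝓝 x) := by
      have : Continuous fun t : ℝ => x + t • v := by fun_prop
      simpa using this.tendsto 0
    obtain ⟨r, hr, hball⟩ := Metric.mem_nhds_iff.1 (hcont hopen)
    have hnn : ∀ t : ℝ, |t| < r → 0 ≤ t * g v := by
      intro t ht
      have hmem : t ∈ Metric.ball (0 : ℝ) r := by simpa using ht
      have := hfg _ (hball hmem)
      rwa [map_add, ← h0, zero_add, map_smul, smul_eq_mul] at this
    have h1 := hnn (r / 2) (by rw [abs_of_pos (by linarith)]; linarith)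
    have h2 := hnn (-(r / 2)) (by rw [abs_neg, abs_of_pos (by linarith)]; linarith)
    rw [zero_apply]
    nlinarith
  obtain ⟨v, hv1, hv⟩ := StrongDual.exists_lt_apply f (r := 1 / 2) (by rw [hf]; norm_num)
  have hgv : 0 < g v := hpos v (by linarith)
  let K : Submodule ℝ X := LinearMap.ker g.toLinearMap
  have hK : ∀ x : K, |f x| ≤ 1 / 2 * ‖(x : X)‖ := by
    intro x
    have hx0 : g x = 0 := x.2
    by_contra! h
    rcases abs_cases (f x) with ⟨h1, _⟩ | ⟨h1, _⟩
    · rw [h1] at h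
      exact (hpos _ h).ne' hx0
    · rw [h1] at h
      have := hpos (-x) (by rwa [norm_neg, map_neg])
      rw [map_neg, hx0, neg_zero] at this
      exact this.false
  -- On `ker g` the functional `f` has norm at most `1/2`. For a norm-preserving extension `ψ`, the
  -- difference `f - ψ` vanishes on `ker g`, hence is a multiple of `g`.
  obtain ⟨ψ, hψK, hψ⟩ := exists_extension_norm_eq K (f.comp K.subtypeL)
  have hψ1 : ‖ψ‖ ≤ 1 / 2 := by
    rw [hψ]
    exact ContinuousLinearMap.opNorm_le_bound _ (by norm_num) hK
  set c := (f v - ψ v) / g v with hc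
  have hψv : ψ v ≤ 1 / 2 := (ψ.apply_le_norm hv1).trans hψ1
  refine ⟨c, div_pos (by linarith) hgv, ?_⟩
  have hdecomp : f - c • g = ψ := by
    ext x
    have hmem : x - (g x / g v) • v ∈ K := by
      change g (x - (g x / g v) • v) = 0
      rw [map_sub, map_smul, smul_eq_mul, div_mul_cancel₀ _ hgv.ne', sub_self]
    have h1 : ψ (x - (g x / g v) • v) = f (x - (g x / g v) • v) := hψK ⟨_, hmem⟩
    simp only [map_sub, map_smul, smul_eq_mul] at h1
    rw [sub_apply, smul_apply, smul_eq_mul, hc]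
    field_simp at h1 ⊢
    linarith
  rwa [hdecomp]

/-- A version of the Bishop–Phelps–Bollobás theorem. -/
theorem exists_normAttaining_near [CompleteSpace X] {f : StrongDual ℝ X} (hf : ‖f‖ = 1) {z : X}
    (hz : ‖z‖ ≤ 1) :
    ∃ y : X, ‖y‖ = 1 ∧ ‖y - z‖ ≤ 2 * (1 - f z) ∧
      ∃ g : StrongDual ℝ X, g y = ‖g‖ ∧ ‖f - g‖ ≤ 1 / 2 := by
  let B := Metric.closedBall (0 : X) 1
  have : CompleteSpace B := Metric.isClosed_closedBall.completeSpace_coe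
  have hB : ∀ b : B, ‖(b : X)‖ ≤ 1 := fun b => mem_closedBall_zero_iff.1 b.2
  obtain ⟨y, hzy, hmax⟩ := exists_maximal_of_continuous_bddAbove (α := B)
    (φ := fun b => 2 * f b) (by fun_prop)
    ⟨2, by
      rintro _ ⟨b, rfl⟩
      have := f.apply_le_norm (hB b)
      dsimp only
      linarith⟩ ⟨z, mem_closedBall_zero_iff.2 hz⟩
  have hfy : f y ≤ 1 := hf ▸ f.apply_le_norm (hB y)
  -- By maximality of `y`, this open convex cone with apex `y` misses the unit ball; a separating
  -- functional, with its sign changed, attains its norm at `y`.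
  let s : Set X := {x | 1 / 2 * ‖x - y‖ < f x - f y}
  have hsconv : Convex ℝ s := by
    intro a ha b hb p q hp hq hpq
    simp only [s, mem_ofPred_eq] at *
    have h1 : p • a + q • b - (y : X) = p • (a - y) + q • (b - y) := by
      rw [smul_sub, smul_sub, sub_add_sub_comm, ← add_smul, hpq, one_smul]
    have h2 : ‖p • (a - (y : X)) + q • (b - (y : X))‖ ≤ p * ‖a - y‖ + q * ‖b - y‖ := by
      refine (norm_add_le _ _).trans_eq ?_
      rw [norm_smul, norm_smul, Real.norm_of_nonneg hp, Real.norm_of_nonneg hq]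
    rw [h1, map_add, map_smul, map_smul, smul_eq_mul, smul_eq_mul]
    have h3 : f y = p * f y + q * f y := by rw [← add_mul, hpq, one_mul]
    rcases hp.eq_or_lt with rfl | hp
    · nlinarith
    · nlinarith
  have hsopen : IsOpen s := isOpen_lt (by fun_prop) (by fun_prop)
  have hdisj : Disjoint s B := by
    rw [Set.disjoint_left]
    intro x hx hxB
    have hxs : 1 / 2 * ‖x - y‖ < f x - f y := hx
    have h1 := hmax ⟨x, hxB⟩ (by
      rw [Subtype.dist_eq, dist_comm, dist_eq_norm]
      dsimp only
      linarith)
    have h2 : x = y := congrArg Subtype.val h1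
    rw [h2] at hxs
    simp at hxs
  obtain ⟨g, r, hgs, hgB⟩ := geometric_hahn_banach_open hsconv hsopen (convex_closedBall 0 1) hdisj
  obtain ⟨v, hv1, hv⟩ := StrongDual.exists_lt_apply f (r := 1 / 2) (by rw [hf]; norm_num)
  have hscale : ∀ x : X, 1 / 2 * ‖x‖ < f x → ∀ t : ℝ, 0 < t → g y + t * g x < r := by
    intro x hx t ht
    have := hgs (y + t • x) (by
      simp only [s, mem_ofPred_eq, add_sub_cancel_left, norm_smul, Real.norm_of_nonneg ht.le,
        map_add, map_smul, smul_eq_mul]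
      nlinarith)
    rwa [map_add, map_smul, smul_eq_mul] at this
  have hgyr : g y = r := by
    refine le_antisymm ?_ (hgB y y.2)
    have hlim : Tendsto (fun t : ℝ => g y + t * g v) (𝓝[>] 0) (𝓝 (g y)) := by
      have : Continuous fun t : ℝ => g y + t * g v := by fun_prop
      have h := this.tendsto 0
      rw [zero_mul, add_zero] at h
      exact h.mono_left nhdsWithin_le_nhds
    refine le_of_tendsto hlim ?_
    filter_upwards [self_mem_nhdsWithin] with t ht
    exact (hscale v (by linarith) t ht).le
  have hneg : ∀ x : X, 1 / 2 * ‖x‖ < f x → g x < 0 := by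
    intro x hx
    have := hscale x hx 1 one_pos
    linarith
  have hg0 : -g ≠ 0 := by
    intro h
    have h1 := hneg v (by linarith)
    have h2 : (-g) v = 0 := by rw [h]; rfl
    rw [neg_apply] at h2
    linarith
  obtain ⟨c, hc, hcg⟩ := exists_pos_smul_norm_sub_le hf hg0 fun x hx => by
    rw [neg_apply]
    linarith [hneg x hx]
  have hgy : (-g) y = ‖-g‖ := by
    refine le_antisymm ((-g).apply_le_norm (hB y)) ?_
    refine ContinuousLinearMap.opNorm_le_of_unit_norm ?_ ?_
    · rw [neg_apply, hgyr]
      have := hgB 0 (by simp)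
      rw [map_zero] at this
      linarith
    · intro x hx
      have h1 := hgB x (mem_closedBall_zero_iff.2 hx.le)
      have h2 := hgB (-x) (mem_closedBall_zero_iff.2 (by rw [norm_neg, hx]))
      rw [map_neg] at h2
      rw [neg_apply, neg_apply, hgyr, norm_neg, Real.norm_eq_abs, abs_le]
      constructor <;> linarith
  refine ⟨y, le_antisymm (hB y) ?_, ?_, c • -g, ?_, hcg⟩
  · have h1 := (le_abs_self _).trans ((-g).le_opNorm y)
    rw [hgy] at h1
    have h2 : 0 < ‖-g‖ := norm_pos_iff.2 hg0
    nlinarith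
  · rw [Subtype.dist_eq, dist_comm, dist_eq_norm] at hzy
    dsimp only at hzy
    linarith
  · rw [smul_apply, hgy, norm_smul, Real.norm_of_nonneg hc.le, smul_eq_mul]

end BishopPhelps

/-! ### Existence of atomic parts -/

/-- A nonzero vector whose parts are all multiples of it. -/
structure IsL1Atom {E : Type*} [NormedAddCommGroup E] [NormedSpace ℝ E] (a : E) : Prop where
  ne_zero : a ≠ 0
  exists_smul_eq : ∀ h, IsPart h a → ∃ c : ℝ, h = c • a

section ExistsAtom

variable {X : Type u} [NormedAddCommGroup X] [NormedSpace ℝ X]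

/-- If a nonzero functional attains its norm at both `x` and `y`, then the state space of the
midpoint lies in those of `x` and `y`. -/
theorem stateSpace_half_smul_add {x y : X} (hx : ‖x‖ = 1) (hy : ‖y‖ = 1) {f : StrongDual ℝ X}
    (hf0 : f ≠ 0) (hfx : f x = ‖f‖) (hfy : f y = ‖f‖) :
    ‖(1 / 2 : ℝ) • (x + y)‖ = 1 ∧ f ((1 / 2 : ℝ) • (x + y)) = ‖f‖ ∧
      stateSpace ((1 / 2 : ℝ) • (x + y)) ⊆ stateSpace x ∩ stateSpace y := by
  have hle : ‖(1 / 2 : ℝ) • (x + y)‖ ≤ 1 := by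
    rw [norm_smul, Real.norm_of_nonneg (by norm_num)]
    linarith [norm_add_le x y]
  have hf : f ((1 / 2 : ℝ) • (x + y)) = ‖f‖ := by
    rw [map_smul, map_add, hfx, hfy, smul_eq_mul]
    ring
  refine ⟨le_antisymm hle ?_, hf, fun g ⟨hg, hgw⟩ => ?_⟩
  · have h1 := (le_abs_self _).trans (f.le_opNorm ((1 / 2 : ℝ) • (x + y)))
    rw [hf] at h1
    have h2 : 0 < ‖f‖ := norm_pos_iff.2 hf0
    nlinarith
  · have h1 := g.apply_le_norm hx.le
    have h2 := g.apply_le_norm hy.le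
    rw [map_smul, map_add, smul_eq_mul] at hgw
    exact ⟨⟨hg, by linarith⟩, ⟨hg, by linarith⟩⟩

/-- Near every point of the unit ball at which `f` almost attains its norm, a nonzero part of `f`
attains its norm. -/
theorem L1Like.exists_isPart_normAttaining [CompleteSpace X] (hE : L1Like (StrongDual ℝ X))
    {f : StrongDual ℝ X} (hf : ‖f‖ = 1) {z : X} (hz : ‖z‖ ≤ 1) :
    ∃ y : X, ‖y‖ = 1 ∧ ‖y - z‖ ≤ 2 * (1 - f z) ∧
      ∃ h : StrongDual ℝ X, h ≠ 0 ∧ IsPart h f ∧ h y = ‖h‖ := by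
  obtain ⟨y, hy, hyz, g, hgy, hfg⟩ := exists_normAttaining_near hf hz
  obtain ⟨m, hm1, hm2, hm3⟩ := hE.exists_median f g
  refine ⟨y, hy, hyz, m, ?_, hm1, IsPart.apply_eq_norm hm2 hy.le hgy⟩
  rintro rfl
  -- A zero median would give `‖f - g‖ = 1 + ‖g‖`, against `‖f - g‖ ≤ 1/2`.
  rw [sub_zero, hf] at hm3
  linarith [norm_nonneg (g - 0)]

/-- Two different unit vectors contain disjoint parts of equal positive norm. -/
theorem L1Like.exists_isPart_disjoint {E : Type*} [NormedAddCommGroup E] (hE : L1Like E)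
    {a b : E} (ha : ‖a‖ = 1) (hb : ‖b‖ = 1) (hab : a ≠ b) :
    ∃ p q : E, IsPart p a ∧ IsPart q b ∧ 0 < ‖p‖ ∧ ‖q‖ = ‖p‖ ∧ ‖p - q‖ = 2 * ‖p‖ := by
  obtain ⟨m, hm1, hm2, hm3⟩ := hE.exists_median a b
  have hpq : ‖a - b‖ = 2 * ‖a - m‖ := by linarith
  refine ⟨a - m, b - m, IsPart.sub_left hm1, IsPart.sub_left hm2, ?_, by linarith, ?_⟩
  · have : 0 < ‖a - b‖ := norm_pos_iff.2 (sub_ne_zero.2 hab)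
    linarith
  · rw [sub_sub_sub_cancel_right, hpq]

theorem L1Like.exists_isL1Atom_isPart [CompleteSpace X] (hE : L1Like (StrongDual ℝ X))
    (hX : QuasiPolyhedralNorm X) {f : StrongDual ℝ X} (hf : f ≠ 0) :
    ∃ a, IsL1Atom a ∧ IsPart a f := by
  by_contra! hno
  have hnorm : ∀ {g : StrongDual ℝ X}, g ≠ 0 → ‖‖g‖⁻¹ • g‖ = 1 := fun {g} hg => by
    rw [norm_smul, norm_inv, norm_norm, inv_mul_cancel₀ (norm_ne_zero_iff.2 hg)]
  have hback : ∀ {g h : StrongDual ℝ X}, g ≠ 0 → IsPart h (‖g‖⁻¹ • g) → IsPart (‖g‖ • h) g :=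
    fun {g h} hg hh => by
      have := hh.smul ‖g‖
      rwa [smul_inv_smul₀ (norm_ne_zero_iff.2 hg)] at this
  have happ : ∀ {h : StrongDual ℝ X} {c : ℝ} {y : X}, 0 < c → h y = ‖h‖ → (c • h) y = ‖c • h‖ :=
    fun {h c y} hc hh => by
      rw [smul_apply, hh, norm_smul, Real.norm_of_nonneg hc.le, smul_eq_mul]
  let F : Set {x : X // ‖x‖ = 1} := {x | ∃ h : StrongDual ℝ X, h ≠ 0 ∧ IsPart h f ∧ h x = ‖h‖}
  have hF : F.Nonempty := by
    obtain ⟨y, hy, -, h, hh0, hhf, hhy⟩ :=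
      hE.exists_isPart_normAttaining (hnorm hf) (z := 0) (by simp)
    exact ⟨⟨y, hy⟩, ‖f‖ • h, smul_ne_zero (norm_ne_zero_iff.2 hf) hh0, hback hf hhf,
      happ (norm_pos_iff.2 hf) hhy⟩
  obtain ⟨⟨x, hx⟩, ⟨h, hh0, hhf, hhx⟩, hmin⟩ := hX.wellFounded.has_min F hF
  obtain ⟨k, hkh, hk⟩ : ∃ k, IsPart k h ∧ ∀ c : ℝ, k ≠ c • h := by
    by_contra! hcon
    exact hno h ⟨hh0, hcon⟩ hhf
  have hk0 : k ≠ 0 := fun h0 => hk 0 (by rw [h0, zero_smul])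
  have hkx : k x = ‖k‖ := hkh.apply_eq_norm hx.le hhx
  have hne : ‖k‖⁻¹ • k ≠ ‖h‖⁻¹ • h := fun heq => hk (‖k‖ * ‖h‖⁻¹) (by
    rw [mul_smul, ← heq, smul_inv_smul₀ (norm_ne_zero_iff.2 hk0)])
  obtain ⟨p, q, hpk, hqh, hp, hqp, hpq⟩ := hE.exists_isPart_disjoint (hnorm hk0) (hnorm hh0) hne
  have hp0 : p ≠ 0 := norm_pos_iff.1 hp
  have hq0 : q ≠ 0 := norm_pos_iff.1 (hqp ▸ hp)
  have hqx : q x = ‖q‖ := hqh.apply_eq_norm hx.le (happ (inv_pos.2 (norm_pos_iff.2 hh0)) hhx)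
  -- The constant `7/4` makes both `p z` and `-q z` exceed `3/4 * ‖p‖`. So `y` can be found within
  -- `1/2` of `z`, and `q` cannot attain its norm at `y`.
  obtain ⟨z, hz, hzpq⟩ := StrongDual.exists_lt_apply (p - q) (r := 7 / 4 * ‖p‖)
    (by rw [hpq]; linarith)
  rw [sub_apply] at hzpq
  have hpz := p.apply_le_norm hz
  have hqz : -q z ≤ ‖q‖ := (neg_le_abs _).trans (q.unit_le_opNorm z hz)
  obtain ⟨y, hy, hyz, m, hm0, hmp, hmy⟩ := hE.exists_isPart_normAttaining (hnorm hp0) hz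
  have hyz' : ‖y - z‖ ≤ 1 / 2 := by
    refine hyz.trans ?_
    have : 3 / 4 ≤ (‖p‖⁻¹ • p) z := by
      rw [smul_apply, smul_eq_mul, le_inv_mul_iff₀ hp]
      linarith
    linarith
  have hqy : q y < ‖q‖ := by
    have h1 := (le_abs_self _).trans (q.le_opNorm (y - z))
    rw [map_sub] at h1
    have h2 : ‖q‖ * ‖y - z‖ ≤ ‖q‖ * (1 / 2) := by gcongr
    linarith
  have hm1 : IsPart (‖k‖ • ‖p‖ • m) k := hback hk0 ((hback hp0 hmp).trans hpk)
  have hm2 : ‖k‖ • ‖p‖ • m ≠ 0 :=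
    smul_ne_zero (norm_ne_zero_iff.2 hk0) (smul_ne_zero hp.ne' hm0)
  have hm3 : (‖k‖ • ‖p‖ • m) y = ‖‖k‖ • ‖p‖ • m‖ := happ (norm_pos_iff.2 hk0) (happ hp hmy)
  -- The midpoint contradicts minimality: the normalised `q` lies in the state space of `x` but not
  -- in that of `y`.
  obtain ⟨hw, hmw, hsub⟩ := stateSpace_half_smul_add hx hy hm2 (hm1.apply_eq_norm hx.le hkx) hm3
  refine hmin ⟨_, hw⟩ ⟨_, hm2, hm1.trans (hkh.trans hhf), hmw⟩
    ⟨fun g hg => (hsub hg).1, fun hss => ?_⟩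
  have h1 := (hsub (hss (inv_norm_smul_mem_stateSpace hq0 hqx))).2.2
  rw [smul_apply, smul_eq_mul, inv_mul_eq_one₀ (norm_ne_zero_iff.2 hq0)] at h1
  linarith

end ExistsAtom

/-! ### Atoms as the unit basis of `ℓ¹(Γ)` -/

section Representation

variable {E : Type u} [NormedAddCommGroup E] [NormedSpace ℝ E]

theorem IsL1Atom.smul {a : E} (ha : IsL1Atom a) {c : ℝ} (hc : c ≠ 0) : IsL1Atom (c • a) where
  ne_zero := smul_ne_zero hc ha.ne_zero
  exists_smul_eq h hh := by
    have h1 := hh.smul c⁻¹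
    rw [inv_smul_smul₀ hc] at h1
    obtain ⟨d, hd⟩ := ha.exists_smul_eq _ h1
    exact ⟨d, by rw [smul_comm, ← hd, smul_inv_smul₀ hc]⟩

/-- The median is a multiple of both atoms, so it vanishes when their lines differ. -/
theorem L1Like.norm_sub_of_isL1Atom (hE : L1Like E) {a b : E} (ha : IsL1Atom a) (hb : IsL1Atom b)
    (hab : Submodule.span ℝ {a} ≠ Submodule.span ℝ {b}) : ‖a - b‖ = ‖a‖ + ‖b‖ := by
  obtain ⟨m, hm1, hm2, hm3⟩ := hE.exists_median a b
  obtain ⟨c, rfl⟩ := ha.exists_smul_eq m hm1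
  obtain ⟨d, hd⟩ := hb.exists_smul_eq _ hm2
  rcases eq_or_ne c 0 with rfl | hc
  · rw [zero_smul, sub_zero, sub_zero] at hm3
    exact hm3.symm
  · have hd0 : d ≠ 0 := by
      rintro rfl
      rw [zero_smul] at hd
      exact smul_ne_zero hc ha.ne_zero hd
    refine absurd ?_ hab
    rw [← Submodule.span_singleton_smul_eq (IsUnit.mk0 c hc), hd,
      Submodule.span_singleton_smul_eq (IsUnit.mk0 d hd0)]

theorem L1Like.disjoint_smul_of_isL1Atom (hE : L1Like E) {a b : E} (ha : IsL1Atom a)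
    (hb : IsL1Atom b) (hab : Submodule.span ℝ {a} ≠ Submodule.span ℝ {b}) (s t : ℝ) :
    L1Disjoint (s • a) (t • b) := by
  rcases eq_or_ne s 0 with rfl | hs
  · simp [L1Disjoint]
  rcases eq_or_ne t 0 with rfl | ht
  · simp [L1Disjoint]
  have key : ∀ r : ℝ, r ≠ 0 → ‖s • a - r • b‖ = ‖s • a‖ + ‖r • b‖ := fun r hr =>
    hE.norm_sub_of_isL1Atom (ha.smul hs) (hb.smul hr) (by
      rwa [Submodule.span_singleton_smul_eq (IsUnit.mk0 s hs),
        Submodule.span_singleton_smul_eq (IsUnit.mk0 r hr)])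
  refine ⟨?_, key t ht⟩
  have := key (-t) (neg_ne_zero.2 ht)
  rwa [neg_smul, sub_neg_eq_add, norm_neg] at this

theorem L1Like.norm_sum_smul (hE : L1Like E) {Γ : Type*} (e : Γ → E) (he : ∀ i, IsL1Atom (e i))
    (he1 : ∀ i, ‖e i‖ = 1)
    (hinj : ∀ i j, i ≠ j → Submodule.span ℝ {e i} ≠ Submodule.span ℝ {e j}) (c : Γ → ℝ)
    (s : Finset Γ) : ‖∑ i ∈ s, c i • e i‖ = ∑ i ∈ s, |c i| := by
  classical
  have hdisj : ∀ (s : Finset Γ) (j : Γ), j ∉ s → L1Disjoint (∑ i ∈ s, c i • e i) (c j • e j) := by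
    intro s j
    induction s using Finset.induction_on with
    | empty => intro _; simp [L1Disjoint]
    | insert i s hi ih =>
      intro hj
      rw [Finset.mem_insert, not_or] at hj
      rw [Finset.sum_insert hi]
      exact hE.disjoint_add _ _ _
        (hE.disjoint_smul_of_isL1Atom (he i) (he j) (hinj i j (Ne.symm hj.1)) _ _) (ih hj.2)
  induction s using Finset.induction_on with
  | empty => simp
  | insert i s hi ih =>
    rw [Finset.sum_insert hi, Finset.sum_insert hi, add_comm, (hdisj s i hi).1, ih, norm_smul, he1,
      mul_one, Real.norm_eq_abs, add_comm]

/-- The isometry of `ℓ¹(Γ)` into a Banach space given by an isometric copy of its unit basis. -/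
theorem exists_linearIsometry_lp_one [CompleteSpace E] {Γ : Type*} (e : Γ → E)
    (he1 : ∀ i, ‖e i‖ = 1)
    (he : ∀ (c : Γ → ℝ) (s : Finset Γ), ‖∑ i ∈ s, c i • e i‖ = ∑ i ∈ s, |c i|) :
    ∃ T : lp (fun _ : Γ => ℝ) 1 →ₗᵢ[ℝ] E, ∀ i, e i ∈ range T := by
  classical
  have hnorm : ∀ c : lp (fun _ : Γ => ℝ) 1, HasSum (fun i => |c i|) ‖c‖ := fun c => by
    simpa using lp.hasSum_norm (p := 1) (by simp) c
  have hsum : ∀ c : lp (fun _ : Γ => ℝ) 1, Summable fun i => c i • e i := fun c =>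
    Summable.of_norm ((hnorm c).summable.congr fun i => by
      rw [norm_smul, he1, mul_one, Real.norm_eq_abs])
  let T : lp (fun _ : Γ => ℝ) 1 →ₗ[ℝ] E :=
    { toFun := fun c => ∑' i, c i • e i
      map_add' := fun c d => by
        rw [← (hsum c).tsum_add (hsum d)]
        exact tsum_congr fun i => add_smul _ _ _
      map_smul' := fun r c => by
        rw [RingHom.id_apply, ← (hsum c).tsum_const_smul]
        exact tsum_congr fun i => mul_smul r (c i) (e i) }
  refine ⟨⟨T, fun c => ?_⟩, fun i => ⟨lp.single 1 i 1, ?_⟩⟩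
  · have h1 : Tendsto (fun s : Finset Γ => ‖∑ i ∈ s, c i • e i‖) atTop (𝓝 ‖T c‖) :=
      (hsum c).hasSum.norm
    simp only [he] at h1
    exact tendsto_nhds_unique h1 (hnorm c)
  · change ∑' j, (lp.single 1 i (1 : ℝ) : Γ → ℝ) j • e j = e i
    rw [tsum_eq_single i fun j hj => by simp [hj]]
    simp

/-- An `L¹`-like Banach space in which every nonzero vector has an atomic part is an `ℓ¹`-space. -/
theorem L1Like.exists_linearIsometryEquiv_lp_one [CompleteSpace E] (hE : L1Like E)
    (hat : ∀ f : E, f ≠ 0 → ∃ a, IsL1Atom a ∧ IsPart a f) :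
    ∃ Γ : Type u, Nonempty (E ≃ₗᵢ[ℝ] lp (fun _ : Γ => ℝ) 1) := by
  let Γ : Type u := {L : Submodule ℝ E // ∃ a, IsL1Atom a ∧ ‖a‖ = 1 ∧ Submodule.span ℝ {a} = L}
  let e : Γ → E := fun L => L.2.choose
  have heat : ∀ i, IsL1Atom (e i) := fun i => i.2.choose_spec.1
  have he1 : ∀ i, ‖e i‖ = 1 := fun i => i.2.choose_spec.2.1
  have hspan : ∀ i, Submodule.span ℝ {e i} = i.1 := fun i => i.2.choose_spec.2.2
  obtain ⟨T, hT⟩ := exists_linearIsometry_lp_one e he1 (hE.norm_sum_smul e heat he1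
    fun i j hij => by
      rw [hspan, hspan]
      exact fun h => hij (Subtype.ext h))
  have hatR : ∀ a : E, IsL1Atom a → a ∈ range T := by
    intro a ha
    have hna : ‖a‖ ≠ 0 := norm_ne_zero_iff.2 ha.ne_zero
    have hunit : IsUnit ‖a‖⁻¹ := IsUnit.mk0 _ (inv_ne_zero hna)
    let i : Γ := ⟨Submodule.span ℝ {a}, ‖a‖⁻¹ • a, ha.smul (inv_ne_zero hna),
      by rw [norm_smul, norm_inv, norm_norm, inv_mul_cancel₀ hna],
      Submodule.span_singleton_smul_eq hunit a⟩
    have hmem : a ∈ Submodule.span ℝ {e i} := by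
      rw [hspan i]
      exact Submodule.mem_span_singleton_self a
    obtain ⟨c, hc⟩ := Submodule.mem_span_singleton.1 hmem
    obtain ⟨d, hd⟩ := hT i
    exact ⟨c • d, by rw [map_smul, hd, hc]⟩
  have hsurj : Function.Surjective T := by
    intro f
    -- Adding an atomic part of `f - T b` to the approximation would lower the error by exactly the
    -- distance moved, which Ekeland's principle forbids.
    obtain ⟨b, -, hb⟩ := exists_maximal_of_continuous_bddAbove (φ := fun c => -‖f - T c‖)
      (by fun_prop) ⟨0, by rintro _ ⟨c, rfl⟩; simp⟩ 0
    refine ⟨b, ?_⟩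
    by_contra hne
    obtain ⟨a, ha, hpart⟩ := hat (f - T b) (sub_ne_zero.2 (Ne.symm hne))
    obtain ⟨d, rfl⟩ := hatR a ha
    have h1 := hb (b + d) (by
      rw [dist_self_add_right, map_add, ← sub_sub, ← T.norm_map d]
      rw [IsPart] at hpart
      linarith)
    rw [add_eq_left] at h1
    exact ha.ne_zero (by rw [h1, map_zero])
  exact ⟨Γ, ⟨(LinearIsometryEquiv.ofSurjective T hsurj).symm⟩⟩

end Representation

theorem mainTheorem4 (X : Type u) [NormedAddCommGroup X] [NormedSpace ℝ X] [CompleteSpace X]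
    (hX : IsL1Predual.{u, v} X) (hssd : StronglySubdifferentiableNorm X) :
    QuasiPolyhedralNorm X ∧
      ∃ Γ : Type u, Nonempty (StrongDual ℝ X ≃ₗᵢ[ℝ] lp (fun _ : Γ => ℝ) 1) := by
  have hE := hX.l1Like_dual
  have hqp := hE.quasiPolyhedralNorm hssd
  exact ⟨hqp, hE.exists_linearIsometryEquiv_lp_one fun _ hf => hE.exists_isL1Atom_isPart hqp hf⟩
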